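/- Let $G=(V,E,\bm b)$ be a connected power network: a finite connected simple undirected graph $(V,E)$ in which every line (edge) $\ell\in E$ has a susceptance $b_\ell>0$ and an arbitrarily chosen orientation. Let $C\in\{-1,0,1\}^{V\times E}$ be the incidence matrix, with $C_{i\ell}=1$ if $i$ is the source of $\ell$, $C_{i\ell}=-1$ if $i$ is its target and $C_{i\ell}=0$ otherwise, let $B=\mathrm{diag}(b_\ell)_{\ell\in E}$ and let $L=CBC^T$. For an injection vector $\bm p\in\mathrm{im}(L)$ (a balanced one), let $\bm f=\bm f(\bm p)\in\mathbb R^E$ be the unique vector of line flows for which $\bm p=C\bm f$ and $\bm f=BC^T\bm\theta$ for some $\bm\theta\in\mathbb R^V$. For lines $\ell$ and $\hat\ell=(s,t)$, the power transfer distribution factor is $$D_{\ell\hat\ell}=\frac{f_\ell\big(\bm p+\delta(\mathbf e_s-\mathbf e_t)\big)-f_\ell(\bm p)}{\delta},$$ where $\bm p$ is any balanced injection vector and $\delta\neq0$ any real number. Theorem (Simple Cycle Criterion for PTDF). Let $\ell\neq\hat\ell$ be two distinct lines of $G$. If there is no simple cycle in $G$ that contains both $\ell$ and $\hat\ell$,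 then $D_{\ell\hat\ell}=0$ (for every balanced $\bm p$ and every $\delta\neq 0$). -/

import Mathlib

/-- A power network `(V, E, b)`: a simple undirected graph with vertices (buses) `V` and
lines `E`, with an arbitrary orientation `src ℓ → tgt ℓ` chosen for every line `ℓ` and a
positive susceptance `b ℓ`. There are no loops and no parallel lines. -/
structure PowerNetwork (V E : Type*) where
  /-- source of a line in the chosen orientation -/
  src : E → V
  /-- target of a line in the chosen orientation -/
  tgt : E → V
  src_ne_tgt : ∀ e, src e ≠ tgt e
  ends_injective : Function.Injective fun e => s(src e, tgt e)
  /-- susceptance of a line -/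
  b : E → ℝ
  b_pos : ∀ e, 0 < b e

namespace PowerNetwork

/-- The unordered pair of end points of a line. -/
def ends {V E : Type*} (N : PowerNetwork V E) (e : E) : Sym2 V := s(N.src e, N.tgt e)

/-- The underlying undirected, unweighted graph. -/
def graph {V E : Type*} (N : PowerNetwork V E) : SimpleGraph V where
  Adj u v := ∃ e, N.ends e = s(u, v)
  symm := ⟨fun u v ⟨e, he⟩ => ⟨e, he.trans Sym2.eq_swap⟩⟩
  loopless := ⟨fun u ⟨e, he⟩ => N.src_ne_tgt e <| by
    rcases Sym2.eq_iff.1 he with h | h <;> exact h.1.trans h.2.symm⟩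

/-- Some simple cycle of the network contains both lines `e` and `e'`. -/
def HasSimpleCycleThrough {V E : Type*} (N : PowerNetwork V E) (e e' : E) : Prop :=
  ∃ (v : V) (c : N.graph.Walk v v), c.IsCycle ∧ N.ends e ∈ c.edges ∧ N.ends e' ∈ c.edges

/-- The vertex-line incidence matrix `C`. -/
def incidence {V E : Type*} [DecidableEq V] (N : PowerNetwork V E) : Matrix V E ℝ :=
  Matrix.of fun i e => if i = N.src e then 1 else if i = N.tgt e then -1 else 0

/-- The diagonal matrix `B` of the susceptances. -/
def susceptance {V E : Type*} [DecidableEq E] (N : PowerNetwork V E) : Matrix E E ℝ :=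
  Matrix.diagonal N.b

/-- The weighted Laplacian matrix `L = C B Cᵀ`. -/
def laplacian {V E : Type*} [DecidableEq V] [DecidableEq E] [Fintype E]
    (N : PowerNetwork V E) : Matrix V V ℝ :=
  N.incidence * N.susceptance * N.incidence.transpose

/-- An injection vector is balanced if it lies in the image of the Laplacian. -/
def Balanced {V E : Type*} [DecidableEq V] [DecidableEq E] [Fintype V] [Fintype E]
    (N : PowerNetwork V E) (p : V → ℝ) : Prop :=
  ∃ θ : V → ℝ, N.laplacian.mulVec θ = p

/-- `f` is a vector of line flows that solves, with some vector `θ` of phase angles, the DC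
power flow equations `p = C f`, `f = B Cᵀ θ` for the injections `p`. -/
def IsDCFlow {V E : Type*} [DecidableEq V] [DecidableEq E] [Fintype V] [Fintype E]
    (N : PowerNetwork V E) (p : V → ℝ) (f : E → ℝ) : Prop :=
  ∃ θ : V → ℝ, p = N.incidence.mulVec f ∧
    f = (N.susceptance * N.incidence.transpose).mulVec θ

/-- `xᵀ L x = 0` forces `Cᵀ x = 0`. -/
theorem incidence_transpose_mulVec_eq_zero {V E : Type*} [DecidableEq V] [DecidableEq E]
    [Fintype V] [Fintype E] (N : PowerNetwork V E) {x : V → ℝ}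
    (h : N.laplacian.mulVec x = 0) : N.incidence.transpose.mulVec x = 0 := by
  set y := N.incidence.transpose.mulVec x with hy
  have h1 : x ⬝ᵥ N.laplacian.mulVec x = ∑ e, N.b e * y e ^ 2 := by
    rw [laplacian, ← Matrix.mulVec_mulVec, ← Matrix.mulVec_mulVec, Matrix.dotProduct_mulVec,
      ← Matrix.mulVec_transpose, ← hy, susceptance, dotProduct]
    refine Finset.sum_congr rfl fun e _ => ?_
    rw [Matrix.mulVec_diagonal]
    ring
  rw [h, dotProduct_zero] at h1
  have h2 := (Finset.sum_eq_zero_iff_of_nonneg fun e _ =>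
    mul_nonneg (N.b_pos e).le (sq_nonneg (y e))).1 h1.symm
  funext e
  have h3 := h2 e (Finset.mem_univ e)
  simpa [(N.b_pos e).ne'] using h3

/-- For balanced injections the DC power flow equations have exactly one solution `f`. -/
theorem existsUnique_isDCFlow {V E : Type*} [DecidableEq V] [DecidableEq E] [Fintype V]
    [Fintype E] (N : PowerNetwork V E) {p : V → ℝ} (hp : N.Balanced p) :
    ∃! f, N.IsDCFlow p f := by
  obtain ⟨θ, rfl⟩ := hp
  refine ⟨(N.susceptance * N.incidence.transpose).mulVec θ,
    ⟨θ, by rw [Matrix.mulVec_mulVec, laplacian, Matrix.mul_assoc], rfl⟩, ?_⟩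
  rintro f ⟨θ', h, rfl⟩
  rw [Matrix.mulVec_mulVec, ← Matrix.mul_assoc] at h
  have h0 : N.laplacian.mulVec (θ' - θ) = 0 := by
    rw [Matrix.mulVec_sub, h, laplacian, sub_self]
  have h1 := N.incidence_transpose_mulVec_eq_zero h0
  have h2 : (N.susceptance * N.incidence.transpose).mulVec (θ' - θ) = 0 := by
    rw [← Matrix.mulVec_mulVec, h1, Matrix.mulVec_zero]
  rwa [Matrix.mulVec_sub, sub_eq_zero] at h2

open Classical in
/-- The line flows for the injections `p`: the solution `f` of the DC power flow equations,
which exists and is unique if `p` is balanced (and the value `0` is used otherwise). -/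
noncomputable def lineFlow {V E : Type*} [DecidableEq V] [DecidableEq E] [Fintype V] [Fintype E]
    (N : PowerNetwork V E) (p : V → ℝ) : E → ℝ :=
  if h : ∃ f, N.IsDCFlow p f then h.choose else 0

theorem isDCFlow_lineFlow {V E : Type*} [DecidableEq V] [DecidableEq E] [Fintype V] [Fintype E]
    (N : PowerNetwork V E) {p : V → ℝ} (hp : N.Balanced p) : N.IsDCFlow p (N.lineFlow p) := by
  have h := (N.existsUnique_isDCFlow hp).exists
  rw [lineFlow, dif_pos h]
  exact h.choose_spec

/-- The injections `p` after an increase by `δ` at `s` and a decrease by `δ` at `t`. -/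
def shiftInjection {V : Type*} [DecidableEq V] (p : V → ℝ) (δ : ℝ) (s t : V) : V → ℝ :=
  p + δ • (Pi.single s 1 - Pi.single t 1)

/-- In a connected network, injections are balanced if and only if they sum to zero. -/
theorem balanced_iff {V E : Type*} [DecidableEq V] [DecidableEq E] [Fintype V] [Fintype E]
    (N : PowerNetwork V E) (hN : N.graph.Connected) (p : V → ℝ) :
    N.Balanced p ↔ ∑ i, p i = 0 := by
  have hC (e : E) (x : V → ℝ) :
      N.incidence.transpose.mulVec x e = x (N.src e) - x (N.tgt e) := by
    have hk (i : V) : N.incidence.transpose e i * x i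
        = (if i = N.src e then x i else 0) - (if i = N.tgt e then x i else 0) := by
      have := N.src_ne_tgt e
      simp only [Matrix.transpose_apply, incidence, Matrix.of_apply]
      split_ifs with h1 h2 <;> simp_all
    rw [Matrix.mulVec, dotProduct, Finset.sum_congr rfl fun i _ => hk i]
    simp [Finset.sum_sub_distrib]
  have hsum (x : V → ℝ) : ∑ i, N.laplacian.mulVec x i = 0 := by
    have h1 : N.incidence.transpose.mulVec 1 = 0 := by
      funext e
      simp [hC]
    rw [← one_dotProduct, laplacian, Matrix.mul_assoc, ← Matrix.mulVec_mulVec,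
      Matrix.dotProduct_mulVec, ← Matrix.mulVec_transpose, h1, zero_dotProduct]
  refine ⟨?_, fun hp => ?_⟩
  · rintro ⟨θ, rfl⟩
    exact hsum θ
  have : Nonempty V := hN.nonempty
  let M : (V → ℝ) →ₗ[ℝ] (V → ℝ) :=
    N.laplacian.mulVecLin + LinearMap.pi fun _ => ∑ i, LinearMap.proj i
  have hM (x : V → ℝ) (i : V) : M x i = N.laplacian.mulVec x i + ∑ j, x j := by simp [M]
  have hz {x : V → ℝ} (hx : ∑ i, M x i = 0) : ∑ j, x j = 0 := by
    simp only [hM, Finset.sum_add_distrib, hsum, zero_add] at hx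
    simpa [Finset.card_univ, Fintype.card_ne_zero] using hx
  have hinj : Function.Injective M := by
    rw [injective_iff_map_eq_zero]
    intro x hx
    have hs : ∑ j, x j = 0 := hz (by simp [hx])
    have hL : N.laplacian.mulVec x = 0 := by
      funext i
      have := hM x i
      rw [hs, add_zero, hx] at this
      exact this.symm
    have hCx := N.incidence_transpose_mulVec_eq_zero hL
    have hadj {u v : V} (h : N.graph.Adj u v) : x u = x v := by
      obtain ⟨e, he⟩ := h
      have h1 : x (N.src e) = x (N.tgt e) := by
        have := congrFun hCx e
        rw [hC] at this
        exact sub_eq_zero.1 this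
      rcases Sym2.eq_iff.1 he with ⟨rfl, rfl⟩ | ⟨rfl, rfl⟩
      · exact h1
      · exact h1.symm
    have hwalk {u v : V} (w : N.graph.Walk u v) : x u = x v := by
      induction w with
      | nil => rfl
      | cons h _ ih => exact (hadj h).trans ih
    funext i
    have hc (j : V) : x j = x i := hwalk (hN.preconnected j i).some
    simp only [hc] at hs
    simpa [Finset.card_univ, Fintype.card_ne_zero] using hs
  obtain ⟨x, hx⟩ := (LinearMap.injective_iff_surjective.1 hinj) p
  have hs : ∑ j, x j = 0 := hz (by rw [hx, hp])
  refine ⟨x, funext fun i => ?_⟩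
  rw [← hx, hM, hs, add_zero]

/-- In a connected network the shifted injections are again balanced. -/
theorem Balanced.shiftInjection {V E : Type*} [DecidableEq V] [DecidableEq E] [Fintype V]
    [Fintype E] {N : PowerNetwork V E} (hN : N.graph.Connected) {p : V → ℝ}
    (hp : N.Balanced p) (δ : ℝ) (s t : V) : N.Balanced (shiftInjection p δ s t) := by
  rw [balanced_iff N hN] at hp ⊢
  simp [PowerNetwork.shiftInjection, Finset.sum_add_distrib, ← Finset.mul_sum,
    Finset.sum_sub_distrib, hp]

/-- The power transfer distribution factor `D_{ℓ,st}`: the change of the flow on the line `ℓ`,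
divided by `δ`, when the injections `p` are increased by `δ` at `s` and decreased by `δ`
at `t`. -/
noncomputable def ptdf {V E : Type*} [DecidableEq V] [DecidableEq E] [Fintype V] [Fintype E]
    (N : PowerNetwork V E) (p : V → ℝ) (δ : ℝ) (ℓ : E) (s t : V) : ℝ :=
  (N.lineFlow (shiftInjection p δ s t) ℓ - N.lineFlow p ℓ) / δ

/-- The entry `D_{ℓℓ'}` of the PTDF matrix: the factor `D_{ℓ,st}` for the end points `s`, `t`
of the (oriented) line `ℓ'`. -/
noncomputable def ptdfMatrix {V E : Type*} [DecidableEq V] [DecidableEq E] [Fintype V]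
    [Fintype E] (N : PowerNetwork V E) (p : V → ℝ) (δ : ℝ) : Matrix E E ℝ :=
  Matrix.of fun ℓ ℓ' => N.ptdf p δ ℓ (N.src ℓ') (N.tgt ℓ')

end PowerNetwork

/-! By linearity, the flow change divided by `δ` is `B Cᵀ x`, where `L x = e_s - e_t`; it vanishes
on `ℓ` exactly when `x` agrees at both ends of `ℓ`. Suppose instead that `ℓ = ab` with `x b < x a`.
Away from `s` no vertex has positive injection, so by a discrete maximum principle
(`exists_adj_lt_of_laplacian_mulVec_nonpos`) one can climb from `a` to `s`; likewise one can descend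
from `b` to `t`. The climb stays at values at least `x a` and the descent at values at most `x b`,
so the two paths are disjoint. Joined by `ℓ` and `ℓ'`, they form a simple cycle
(`SimpleGraph.exists_isCycle_of_lt`). -/

/-! ### Monotone paths and cycles in a graph -/

/-- If every vertex other than `s` that has a strictly lower neighbour also has a strictly higher
one, then from a vertex with a strictly lower neighbour one can climb to `s`. -/
theorem SimpleGraph.exists_isPath_forall_le {V : Type*} [Finite V] (G : SimpleGraph V)
    (f : V → ℝ) (s : V)
    (h : ∀ v, v ≠ s → (∃ w, G.Adj v w ∧ f w < f v) → ∃ u, G.Adj v u ∧ f v < f u)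
    (v : V) (hv : ∃ w, G.Adj v w ∧ f w < f v) :
    ∃ p : G.Walk v s, p.IsPath ∧ ∀ u ∈ p.support, f v ≤ f u := by
  -- The induction runs from large values of `f` to small ones; finiteness of `V` makes this order
  -- well-founded.
  have : IsTrans V fun u v => f v < f u := ⟨fun _ _ _ h₁ h₂ => h₂.trans h₁⟩
  have : Std.Irrefl fun u v : V => f v < f u := ⟨fun u => lt_irrefl (f u)⟩
  induction v using (Finite.wellFounded_of_trans_of_irrefl
    fun u v : V => f v < f u).induction with
  | _ v ih =>
    by_cases hs : v = s
    · subst hs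
      exact ⟨.nil, .nil, by simp⟩
    · obtain ⟨u, hvu, hlt⟩ := h v hs hv
      -- The vertex just left is a strictly lower neighbour of `u`, so the climb can continue.
      obtain ⟨p, hp, hle⟩ := ih u hlt ⟨v, hvu.symm, hlt⟩
      refine ⟨.cons hvu p, hp.cons fun hmem => (hle v hmem).not_gt hlt, fun w hw => ?_⟩
      rw [SimpleGraph.Walk.support_cons, List.mem_cons] at hw
      rcases hw with rfl | hw
      · exact le_rfl
      · exact hlt.le.trans (hle w hw)

/-- If `f` has no local maximum other than `s` and no local minimum other than `t` (at vertices
where it is not locally constant), then every edge along which `f` is not constant lies on a simple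
cycle through the edge `s t`. -/
theorem SimpleGraph.exists_isCycle_of_lt {V : Type*} [Finite V] (G : SimpleGraph V)
    (f : V → ℝ) {s t : V} (hst : G.Adj s t)
    (hs : ∀ v, v ≠ s → (∃ w, G.Adj v w ∧ f w < f v) → ∃ u, G.Adj v u ∧ f v < f u)
    (ht : ∀ v, v ≠ t → (∃ w, G.Adj v w ∧ f v < f w) → ∃ u, G.Adj v u ∧ f u < f v)
    {a b : V} (hab : G.Adj a b) (hlt : f b < f a) (hne : s(a, b) ≠ s(s, t)) :
    ∃ (v : V) (c : G.Walk v v), c.IsCycle ∧ s(a, b) ∈ c.edges ∧ s(s, t) ∈ c.edges := by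
  obtain ⟨p, hp, hpa⟩ := G.exists_isPath_forall_le f s hs a ⟨b, hab, hlt⟩
  obtain ⟨q, hq, hqb⟩ := G.exists_isPath_forall_le (fun v => -f v) t
    (by simpa only [neg_lt_neg_iff] using ht) b ⟨a, hab.symm, neg_lt_neg hlt⟩
  have hdisj {u : V} (hu : u ∈ p.support) (hu' : u ∈ q.support) : False := by
    have h₁ := hpa u hu
    have h₂ := neg_le_neg_iff.1 (hqb u hu')
    linarith
  have hr : (p.reverse.append (.cons hab q)).IsPath := by
    rw [SimpleGraph.Walk.isPath_def, SimpleGraph.Walk.support_append,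
      SimpleGraph.Walk.support_cons, List.tail_cons, SimpleGraph.Walk.support_reverse]
    refine List.Nodup.append (List.nodup_reverse.2 hp.support_nodup) hq.support_nodup ?_
    exact fun u hu hu' => hdisj (List.mem_reverse.1 hu) hu'
  -- The cycle is `t → s`, back along `p` to `a`, across to `b`, then along `q` to `t`. The edge
  -- `st` is not used twice, since otherwise `t` would lie on `p`, or `s` on `q`, or `ab` would be
  -- `st`.
  refine ⟨t, .cons hst.symm (p.reverse.append (.cons hab q)), ?_, ?_, ?_⟩
  · rw [SimpleGraph.Walk.cons_isCycle_iff]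
    refine ⟨hr, fun hmem => ?_⟩
    rw [SimpleGraph.Walk.edges_append, SimpleGraph.Walk.edges_cons,
      SimpleGraph.Walk.edges_reverse, List.mem_append, List.mem_cons, List.mem_reverse] at hmem
    rcases hmem with hmem | hmem | hmem
    · exact hdisj (p.fst_mem_support_of_mem_edges hmem) q.end_mem_support
    · exact hne (hmem.symm.trans Sym2.eq_swap)
    · exact hdisj p.end_mem_support (q.snd_mem_support_of_mem_edges hmem)
  · simp
  · simp [Sym2.eq_swap]

/-! ### Maximum principle for the weighted Laplacian -/

namespace PowerNetwork

theorem incidence_transpose_mulVec_apply {V E : Type*} [DecidableEq V] [Fintype V]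
    (N : PowerNetwork V E) (x : V → ℝ) (e : E) :
    N.incidence.transpose.mulVec x e = x (N.src e) - x (N.tgt e) := by
  have hk (i : V) : N.incidence.transpose e i * x i
      = (if i = N.src e then x i else 0) - (if i = N.tgt e then x i else 0) := by
    have := N.src_ne_tgt e
    simp only [Matrix.transpose_apply, incidence, Matrix.of_apply]
    split_ifs with h1 h2 <;> simp_all
  rw [Matrix.mulVec, dotProduct, Finset.sum_congr rfl fun i _ => hk i]
  simp [Finset.sum_sub_distrib]

theorem susceptance_mul_incidence_transpose_mulVec_apply {V E : Type*} [DecidableEq V]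
    [DecidableEq E] [Fintype V] [Fintype E] (N : PowerNetwork V E) (x : V → ℝ) (e : E) :
    (N.susceptance * N.incidence.transpose).mulVec x e
      = N.b e * (x (N.src e) - x (N.tgt e)) := by
  rw [← Matrix.mulVec_mulVec, susceptance, Matrix.mulVec_diagonal,
    incidence_transpose_mulVec_apply]

theorem laplacian_mulVec_apply {V E : Type*} [DecidableEq V] [DecidableEq E] [Fintype V]
    [Fintype E] (N : PowerNetwork V E) (x : V → ℝ) (v : V) :
    N.laplacian.mulVec x v
      = ∑ e, N.incidence v e * (N.b e * (x (N.src e) - x (N.tgt e))) := by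
  rw [laplacian, Matrix.mul_assoc, ← Matrix.mulVec_mulVec, Matrix.mulVec, dotProduct]
  simp only [susceptance_mul_incidence_transpose_mulVec_apply]

/-- A vertex that does not inject power and has a neighbour of smaller phase angle has a neighbour
of larger phase angle. -/
theorem exists_adj_lt_of_laplacian_mulVec_nonpos {V E : Type*} [DecidableEq V] [DecidableEq E]
    [Fintype V] [Fintype E] (N : PowerNetwork V E) (x : V → ℝ) {v : V}
    (hv : N.laplacian.mulVec x v ≤ 0) (hw : ∃ w, N.graph.Adj v w ∧ x w < x v) :
    ∃ u, N.graph.Adj v u ∧ x v < x u := by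
  by_contra! hmax
  obtain ⟨w, ⟨e, he⟩, hlt⟩ := hw
  -- At a local maximum every line carries a nonnegative flow out of `v`, and the line to `w` a
  -- positive one, so the net injection would be positive.
  refine hv.not_gt ?_
  rw [laplacian_mulVec_apply]
  refine Finset.sum_pos' (fun e _ => ?_) ⟨e, Finset.mem_univ e, ?_⟩
  · simp only [incidence, Matrix.of_apply]
    split_ifs with h₁ h₂
    · have := hmax (N.tgt e) ⟨e, by rw [h₁, ends]⟩
      rw [h₁] at this
      rw [one_mul]
      exact mul_nonneg (N.b_pos e).le (sub_nonneg.2 this)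
    · have := hmax (N.src e) ⟨e, by rw [h₂, ends, Sym2.eq_swap]⟩
      rw [h₂] at this
      rw [neg_one_mul, ← mul_neg, neg_sub]
      exact mul_nonneg (N.b_pos e).le (sub_nonneg.2 this)
    · rw [zero_mul]
  · simp only [incidence, Matrix.of_apply]
    rcases Sym2.eq_iff.1 he with ⟨rfl, rfl⟩ | ⟨rfl, rfl⟩
    · rw [if_pos rfl, one_mul]
      exact mul_pos (N.b_pos e) (sub_pos.2 hlt)
    · rw [if_neg (N.src_ne_tgt e).symm, if_pos rfl, neg_one_mul, ← mul_neg, neg_sub]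
      exact mul_pos (N.b_pos e) (sub_pos.2 hlt)

/-- For a unit injection along the line `ℓ'`, the end points of a line `ℓ` that is on no common
simple cycle with `ℓ'` have the same phase angle. -/
theorem eq_of_not_hasSimpleCycleThrough {V E : Type*} [DecidableEq V] [DecidableEq E]
    [Fintype V] [Fintype E] (N : PowerNetwork V E) {ℓ ℓ' : E} (hne : ℓ ≠ ℓ')
    (hcycle : ¬ N.HasSimpleCycleThrough ℓ ℓ') {x : V → ℝ}
    (hx : N.laplacian.mulVec x = Pi.single (N.src ℓ') 1 - Pi.single (N.tgt ℓ') 1) :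
    x (N.src ℓ) = x (N.tgt ℓ) := by
  have hs (v : V) (hv : v ≠ N.src ℓ') (hw : ∃ w, N.graph.Adj v w ∧ x w < x v) :
      ∃ u, N.graph.Adj v u ∧ x v < x u := by
    refine N.exists_adj_lt_of_laplacian_mulVec_nonpos x ?_ hw
    rw [hx, Pi.sub_apply, Pi.single_eq_of_ne hv, zero_sub, neg_nonpos, Pi.single_apply]
    split_ifs <;> norm_num
  have ht (v : V) (hv : v ≠ N.tgt ℓ') (hw : ∃ w, N.graph.Adj v w ∧ x v < x w) :
      ∃ u, N.graph.Adj v u ∧ x u < x v := by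
    -- Negating `x` exchanges the roles of source and sink.
    have h := N.exists_adj_lt_of_laplacian_mulVec_nonpos (-x) (v := v) ?_
      (by simpa only [Pi.neg_apply, neg_lt_neg_iff] using hw)
    · simpa only [Pi.neg_apply, neg_lt_neg_iff] using h
    · rw [Matrix.mulVec_neg, hx, Pi.neg_apply, Pi.sub_apply, Pi.single_eq_of_ne hv, sub_zero,
        neg_nonpos, Pi.single_apply]
      split_ifs <;> norm_num
  have hends : N.ends ℓ ≠ N.ends ℓ' := fun h => hne (N.ends_injective h)
  -- Stated for either orientation of `ℓ`, so that both strict inequalities are excluded.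
  have key {a b : V} (hab : N.ends ℓ = s(a, b)) : ¬ x b < x a := by
    intro hlt
    obtain ⟨v, c, hc, h₁, h₂⟩ := N.graph.exists_isCycle_of_lt x (s := N.src ℓ')
      (t := N.tgt ℓ') ⟨ℓ', rfl⟩ hs ht ⟨ℓ, hab⟩ hlt (by rw [← hab]; exact hends)
    exact hcycle ⟨v, c, hc, by rwa [hab], h₂⟩
  exact le_antisymm (not_lt.1 (key rfl)) (not_lt.1 (key Sym2.eq_swap))

end PowerNetwork

/-! ### Reduction to a unit injection -/

theorem mainTheorem6 {V E : Type*} [Fintype V] [DecidableEq V] [Fintype E] [DecidableEq E]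
    (N : PowerNetwork V E) (hN : N.graph.Connected) (ℓ ℓ' : E) (hne : ℓ ≠ ℓ')
    (hcycle : ¬ N.HasSimpleCycleThrough ℓ ℓ')
    (p : V → ℝ) (hp : N.Balanced p) (δ : ℝ) (hδ : δ ≠ 0) :
    N.ptdfMatrix p δ ℓ ℓ' = 0 := by
  -- Both injections are balanced, the shifted one by connectedness, so `lineFlow` is a true
  -- solution and not its default `0`.
  obtain ⟨θ₀, h₀, hf₀⟩ := N.isDCFlow_lineFlow hp
  obtain ⟨θ₁, h₁, hf₁⟩ := N.isDCFlow_lineFlow (hp.shiftInjection hN δ (N.src ℓ') (N.tgt ℓ'))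
  rw [hf₀, Matrix.mulVec_mulVec, ← Matrix.mul_assoc, ← PowerNetwork.laplacian] at h₀
  rw [hf₁, Matrix.mulVec_mulVec, ← Matrix.mul_assoc, ← PowerNetwork.laplacian] at h₁
  have hx : N.laplacian.mulVec (δ⁻¹ • (θ₁ - θ₀))
      = Pi.single (N.src ℓ') 1 - Pi.single (N.tgt ℓ') 1 := by
    rw [Matrix.mulVec_smul, Matrix.mulVec_sub, ← h₁, ← h₀, PowerNetwork.shiftInjection,
      add_sub_cancel_left, inv_smul_smul₀ hδ]
  have h := N.eq_of_not_hasSimpleCycleThrough hne hcycle hx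
  simp only [Pi.smul_apply, smul_eq_mul, Pi.sub_apply] at h
  have h' := mul_left_cancel₀ (inv_ne_zero hδ) h
  rw [PowerNetwork.ptdfMatrix, Matrix.of_apply, PowerNetwork.ptdf, hf₁, hf₀,
    N.susceptance_mul_incidence_transpose_mulVec_apply,
    N.susceptance_mul_incidence_transpose_mulVec_apply, ← mul_sub, div_eq_zero_iff]
  left
  rw [mul_eq_zero]
  right
  linarith
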